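/- Let $m\ge 1$ and $n=m^2$, and arrange $n$ nodes in the two-dimensional $m\times m$ square grid with wrap-around, i.e. the nodes are the elements of $(\mathbb Z/m\mathbb Z)^2$ and node $(x,y)$ has the four neighbours $(x\pm1,y)$, $(x,y\pm1)$ (counted with multiplicity if $m\le 2$). Let $\lambda_e,\lambda>0$. A source generates new versions of an update at the points of a Poisson process of rate $\lambda_e$; it sends its current version to each node at the points of a Poisson process of rate $\lambda/n$; and each node sends its current version to each of its four neighbours at the points of a Poisson process of rate $\lambda/4$. All these Poisson processes are independent. A node that receives a version adopts it if it is newer than its own and otherwise keeps its own. Let $N_s(t)$ be the number of versions generated by the source up to time $t$, let $N_i(t)$ be the version held by node $i$ at time $t$ (with $N_i(0)=0$), and let $X_i(t)=N_s(t)-N_i(t)$ be the version age of node $i$. Then $X_i(t)$ is integrable for all $i$ and $t$, and the limiting average version age $v_1=\lim_{t\to\infty}\mathbb E[X_i(t)]$ exists, is finite, and is the same for all nodes $i$. Put $\beta'=\sqrt3\,e^{-\gamma/2}\,e^{\pi^2/48}\,(2/3)^{2/3}\,\Gamma(1/3)\approx 3.26$, where $\gamma$ is the Euler--Mascheroni constant.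 There is an absolute constant $\nu$, independent of $m$, $\lambda_e$ and $\lambda$, such that for all $m\ge1$ $$v_1\le \frac{2\lambda_e}{\lambda}\left(1+\beta' n^{1/3}\right)+\frac{\lambda_e}{\lambda}\left(2+\nu\log n\right).$$ In particular, for fixed $\lambda_e$ and $\lambda$, $v_1=O(n^{1/3})$ as $n=m^2\to\infty$. -/

import Mathlib

open MeasureTheory ProbabilityTheory Filter Topology Asymptotics
open scoped NNReal

/-- A (homogeneous) Poisson process of rate `r`: almost surely its paths start at `0`, are
nondecreasing and right-continuous; its increments are independent, and the increment over
`(s, t]` has the Poisson distribution with mean `r * (t - s)`. -/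
structure IsPoissonProcess {Ω : Type*} [MeasurableSpace Ω] (P : Measure Ω) (r : ℝ≥0)
    (N : ℝ≥0 → Ω → ℕ) : Prop where
  measurable : ∀ t, Measurable (N t)
  start : ∀ᵐ ω ∂P, N 0 ω = 0
  mono : ∀ᵐ ω ∂P, Monotone fun t => N t ω
  rightCont : ∀ᵐ ω ∂P, ∀ t, ContinuousWithinAt (fun u => N u ω) (Set.Ici t) t
  indepIncrements : HasIndepIncrements N P
  law : ∀ s t, s ≤ t → HasLaw (fun ω => N t ω - N s ω) (poissonMeasure (r * (t - s))) P

namespace Gossip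

/-- The nodes of the `m × m` grid, with wrap-around coordinates. -/
abbrev Node (m : ℕ) : Type := ZMod m × ZMod m

/-- The four directions in which a node has a neighbour. -/
inductive Dir : Type
  | east
  | west
  | north
  | south
deriving DecidableEq

/-- The neighbour of a node in a given direction; the four neighbours are distinct from each
other and from the node whenever `3 ≤ m`. -/
def neighbor {m : ℕ} (i : Node m) : Dir → Node m
  | Dir.east => (i.1 + 1, i.2)
  | Dir.west => (i.1 - 1, i.2)
  | Dir.north => (i.1, i.2 + 1)
  | Dir.south => (i.1, i.2 - 1)

/-- The elementary events of the network, each with its own Poisson clock: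
the source generates a new version, the source sends its version to node `i`, or
node `i` pushes its version to its neighbour in direction `d`. -/
inductive Event (m : ℕ) : Type
  | update : Event m
  | send (i : Node m) : Event m
  | push (i : Node m) (d : Dir) : Event m

/-- The rates of the Poisson clocks on a grid of `n = m ^ 2` nodes. -/
noncomputable def rate (m : ℕ) (lamE lam : ℝ≥0) : Event m → ℝ≥0
  | Event.update => lamE
  | Event.send _ => lam / (m : ℝ≥0) ^ 2
  | Event.push _ _ => lam / 4

/-- The effect of one event on the versions held by the nodes, when the current version at the
source is `s` and node `j` holds version `K j`. A node that receives a version keeps the newer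
one. -/
def step {m : ℕ} (s : ℕ) (K : Node m → ℕ) : Event m → Node m → ℕ
  | Event.update => K
  | Event.send i => Function.update K i s
  | Event.push i d => Function.update K (neighbor i d) (max (K (neighbor i d)) (K i))

/-- A gossip process on the `m × m` wrap-around grid. `N e t` is the number of occurrences of the
event `e` up to time `t`, so that `N Event.update t` is the version at the source at time `t`,
and `K t ω i` is the version held by node `i` at time `t`. -/
structure IsGossipProcess {Ω : Type*} [MeasurableSpace Ω] (P : Measure Ω) (m : ℕ)
    (lamE lam : ℝ≥0) (N : Event m → ℝ≥0 → Ω → ℕ) (K : ℝ≥0 → Ω → Node m → ℕ) : Prop where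
  poisson : ∀ e, IsPoissonProcess P (rate m lamE lam e) (N e)
  /-- The Poisson clocks are independent (as processes). -/
  indep : iIndepFun (fun e ω t => N e t ω) P
  start : ∀ᵐ ω ∂P, ∀ i, K 0 ω i = 0
  /-- Versions do not change during a time interval without events. -/
  rest : ∀ᵐ ω ∂P, ∀ s t, s ≤ t → (∀ e, N e t ω = N e s ω) → K t ω = K s ω
  /-- If exactly one event occurs during a time interval, versions change by its effect.
  Almost surely no two events are simultaneous, so this determines all changes. -/
  jump : ∀ᵐ ω ∂P, ∀ s t e, s ≤ t → N e t ω = N e s ω + 1 →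
    (∀ e', e' ≠ e → N e' t ω = N e' s ω) → K t ω = step (N Event.update s ω) (K s ω) e

/-- The version age of node `i`: the number of versions by which it is behind the source. -/
def versionAge {Ω : Type*} {m : ℕ} (N : Event m → ℝ≥0 → Ω → ℕ) (K : ℝ≥0 → Ω → Node m → ℕ)
    (i : Node m) (t : ℝ≥0) (ω : Ω) : ℝ :=
  (N Event.update t ω : ℝ) - (K t ω i : ℝ)

/-- The constant `√3 · e^{-γ/2} · e^{π²/48} · (2/3)^{2/3} · Γ(1/3)`, approximately `3.26`. -/
noncomputable def betaPrime : ℝ :=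
  Real.sqrt 3 * Real.exp (-Real.eulerMascheroniConstant / 2) * Real.exp (Real.pi ^ 2 / 48)
    * (2 / 3 : ℝ) ^ (2 / 3 : ℝ) * Real.Gamma (1 / 3)

end Gossip

namespace Gossip

/-! ### Finiteness of the set of events -/

/-! Extend the version age from nodes to sets: the age of `T` is the source version minus the newest
version in `T`. A push from `i` into `T` replaces the age of `T` by that of `insert i T`, so the
mean ages `f_T` satisfy a closed linear system `f_T' = lamE + ∑ (lam / 4) f_{insert i T} - lam (|T|
/ n + |∂T| / 4) f_T`, the sum running over the pushes in the boundary `∂T`. Only larger sets drive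
the equation for `T`, so by induction from large sets to small every `f_T` with `T` nonempty
converges to `lamE / lam * meanAge T`, where `meanAge` solves the stationary recursion
(`tendsto_setAge`). Translation invariance makes the limit the same for all nodes.

For the bound, a set of density at most `1 / 9` satisfies `|∂T| ≥ 4 √|T|`
(`sixteen_mul_card_le_card_boundary_sq`). Hence passing from size `k + 1` down to size `k` costs at
most `1 / √k`, while `meanAge T ≤ n / |T|` always holds. Stopping at size about `J = n^(2/3)` gives
`n / J + 2 √J ≈ 3 n^(1/3)`, and `3 ≤ 2 β'`. Finitely many small grids are absorbed by the
logarithmic term.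

The system is derived from the paths. On fine dyadic grids almost surely every cell has at most one
event, so the state at time `s` is a limit of functions (`chain`) of the Poisson counts before `s`.
It is therefore independent of later counts, and conditioning on the events in `(s, s + h]` gives
the increment of `f_T` up to `O(h^2)`. -/

instance : Fintype Dir :=
  ⟨{Dir.east, Dir.west, Dir.north, Dir.south}, fun d => by cases d <;> simp⟩

/-- The events are the source update, the transmissions to nodes and the pushes along edges. -/
def eventEquiv (m : ℕ) : Unit ⊕ Node m ⊕ (Node m × Dir) ≃ Event m where
  toFun
    | Sum.inl _ => Event.update
    | Sum.inr (Sum.inl i) => Event.send i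
    | Sum.inr (Sum.inr p) => Event.push p.1 p.2
  invFun
    | Event.update => Sum.inl ()
    | Event.send i => Sum.inr (Sum.inl i)
    | Event.push i d => Sum.inr (Sum.inr (i, d))
  left_inv := by rintro (_ | _ | _) <;> rfl
  right_inv := by rintro (_ | _ | _) <;> rfl

instance (m : ℕ) [NeZero m] : Fintype (Event m) := Fintype.ofEquiv _ (eventEquiv m)

instance (m : ℕ) : DecidableEq (Event m) := (eventEquiv m).symm.decidableEq

lemma sum_event {m : ℕ} [NeZero m] {M : Type*} [AddCommMonoid M] (f : Event m → M) :
    ∑ e, f e = f Event.update + (∑ i, f (Event.send i) + ∑ p : Node m × Dir,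
      f (Event.push p.1 p.2)) := by
  rw [← (eventEquiv m).sum_comp, Fintype.sum_sum_type, Fintype.sum_sum_type]
  simp [eventEquiv]

lemma neighbor_add {m : ℕ} (i a : Node m) (d : Dir) : neighbor (i + a) d = neighbor i d + a := by
  cases d <;> ext <;> simp [neighbor] <;> ring

/-! ### The edge boundary -/

section Boundary

variable {m : ℕ} [NeZero m]

/-- The pushes that bring information from outside into the set `T`. -/
def boundary (T : Finset (Node m)) : Finset (Node m × Dir) :=
  {p | p.1 ∉ T ∧ neighbor p.1 p.2 ∈ T}

lemma mem_boundary {T : Finset (Node m)} {p : Node m × Dir} :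
    p ∈ boundary T ↔ p.1 ∉ T ∧ neighbor p.1 p.2 ∈ T := by
  simp [boundary]

/-- Otherwise `A` would be closed under subtracting `1`, hence, going around the cycle, would hold
everywhere. -/
lemma exists_notMem_add_one_mem (A : ZMod m → Prop) (h1 : ∃ x, A x) (h2 : ∃ x, ¬ A x) :
    ∃ x, ¬ A x ∧ A (x + 1) := by
  by_contra! h
  obtain ⟨a, ha⟩ := h1
  obtain ⟨b, hb⟩ := h2
  have key : ∀ k : ℕ, A (a - k) := by
    intro k
    induction k with
    | zero => simpa using ha
    | succ k ih =>
      by_contra hc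
      refine h _ hc ?_
      convert ih using 1
      push_cast
      ring
  have := key (a - b).val
  simp at this
  exact hb this

lemma exists_notMem_sub_one_mem (A : ZMod m → Prop) (h1 : ∃ x, A x) (h2 : ∃ x, ¬ A x) :
    ∃ x, ¬ A x ∧ A (x - 1) := by
  obtain ⟨x, hx, hx'⟩ := exists_notMem_add_one_mem (fun x => A (-x))
    (by obtain ⟨a, ha⟩ := h1; exact ⟨-a, by simpa using ha⟩)
    (by obtain ⟨a, ha⟩ := h2; exact ⟨-a, by simpa using ha⟩)
  refine ⟨-x, hx, ?_⟩
  convert hx' using 1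
  ring

open Classical in
/-- The `y` for which the line `{x | r x y}` is neither empty nor full. -/
noncomputable def partialLines {α : Type*} [Fintype α] (r : α → α → Prop) : Finset α :=
  {y | (∃ x, r x y) ∧ ∃ x, ¬ r x y}

lemma mem_partialLines {α : Type*} [Fintype α] {r : α → α → Prop} {y : α} :
    y ∈ partialLines r ↔ (∃ x, r x y) ∧ ∃ x, ¬ r x y := by
  simp [partialLines]

/-- A cyclic line that is neither empty nor full is entered at least once in each of its two
orientations. Counting boundary pushes direction by direction keeps multiplicities, so no lower
bound on `m` is needed. -/
lemma two_mul_card_partialLines_add_le (T : Finset (Node m)) :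
    2 * (partialLines fun x y => (x, y) ∈ T).card +
      2 * (partialLines fun y x => (x, y) ∈ T).card ≤ (boundary T).card := by
  have hE : (partialLines fun x y => (x, y) ∈ T).card ≤
      ((boundary T).filter fun p => p.2 = Dir.east).card := by
    refine Finset.card_le_card_of_surjOn (fun p => p.1.2) fun y hy => ?_
    rw [Finset.mem_coe, mem_partialLines] at hy
    obtain ⟨x, hx⟩ := exists_notMem_add_one_mem (fun x => (x, y) ∈ T) hy.1 hy.2
    exact ⟨((x, y), Dir.east), by simpa [mem_boundary, neighbor] using hx, rfl⟩
  have hW : (partialLines fun x y => (x, y) ∈ T).card ≤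
      ((boundary T).filter fun p => p.2 = Dir.west).card := by
    refine Finset.card_le_card_of_surjOn (fun p => p.1.2) fun y hy => ?_
    rw [Finset.mem_coe, mem_partialLines] at hy
    obtain ⟨x, hx⟩ := exists_notMem_sub_one_mem (fun x => (x, y) ∈ T) hy.1 hy.2
    exact ⟨((x, y), Dir.west), by simpa [mem_boundary, neighbor] using hx, rfl⟩
  have hN : (partialLines fun y x => (x, y) ∈ T).card ≤
      ((boundary T).filter fun p => p.2 = Dir.north).card := by
    refine Finset.card_le_card_of_surjOn (fun p => p.1.1) fun x hx => ?_
    rw [Finset.mem_coe, mem_partialLines] at hx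
    obtain ⟨y, hy⟩ := exists_notMem_add_one_mem (fun y => (x, y) ∈ T) hx.1 hx.2
    exact ⟨((x, y), Dir.north), by simpa [mem_boundary, neighbor] using hy, rfl⟩
  have hS : (partialLines fun y x => (x, y) ∈ T).card ≤
      ((boundary T).filter fun p => p.2 = Dir.south).card := by
    refine Finset.card_le_card_of_surjOn (fun p => p.1.1) fun x hx => ?_
    rw [Finset.mem_coe, mem_partialLines] at hx
    obtain ⟨y, hy⟩ := exists_notMem_sub_one_mem (fun y => (x, y) ∈ T) hx.1 hx.2
    exact ⟨((x, y), Dir.south), by simpa [mem_boundary, neighbor] using hy, rfl⟩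
  have hsum := Finset.card_eq_sum_card_fiberwise (f := Prod.snd) (s := boundary T)
    (t := (Finset.univ : Finset Dir)) (by simp [Set.MapsTo])
  have huniv : (Finset.univ : Finset Dir) = {Dir.east, Dir.west, Dir.north, Dir.south} := rfl
  rw [huniv] at hsum
  simp at hsum
  omega

/-- If a relation with few pairs contains a full line in one direction, then most of the lines in
the other direction are neither empty nor full. -/
lemma eight_mul_card_le_of_full_line {α : Type*} [Fintype α] (r : α → α → Prop)
    (T : Finset (α × α)) (hT : ∀ x y, (x, y) ∈ T ↔ r x y)
    (hcard : 9 * T.card ≤ Fintype.card α ^ 2) (hfull : ∃ x, ∀ y, r x y) :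
    8 * Fintype.card α ≤ 9 * (partialLines r).card := by
  classical
  obtain ⟨x₀, hx₀⟩ := hfull
  have hcompl : ∀ y, y ∈ (partialLines r)ᶜ → ∀ x, r x y := by
    intro y hy x
    rw [Finset.mem_compl, mem_partialLines] at hy
    by_contra hx
    exact hy ⟨⟨x₀, hx₀ y⟩, x, hx⟩
  have hsub : (Finset.univ : Finset α) ×ˢ (partialLines r)ᶜ ⊆ T := by
    rintro ⟨x, y⟩ hxy
    exact (hT x y).2 (hcompl y (Finset.mem_product.1 hxy).2 x)
  have h1 := Finset.card_le_card hsub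
  rw [Finset.card_product, Finset.card_univ] at h1
  have h2 := Finset.card_add_card_compl (partialLines r)
  have hpos : 0 < Fintype.card α := Fintype.card_pos_iff.2 ⟨x₀⟩
  have h3 : 9 * (partialLines r)ᶜ.card ≤ Fintype.card α := by
    by_contra! h
    nlinarith
  omega

/-- The isoperimetric inequality in the discrete torus, for sets of density at most `1 / 9`. -/
lemma sixteen_mul_card_le_card_boundary_sq (T : Finset (Node m)) (hcard : 9 * T.card ≤ m ^ 2) :
    16 * T.card ≤ (boundary T).card ^ 2 := by
  classical
  have hb := two_mul_card_partialLines_add_le T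
  set a := (partialLines fun x y => (x, y) ∈ T).card
  set b := (partialLines fun y x => (x, y) ∈ T).card
  -- A full line forces `9 * a ≥ 8 * m`, so the boundary has at least `16 m / 9` pushes, and `(16 /
  -- 9)^2 m^2 ≥ 16 m^2 / 9 ≥ 16 |T|`.
  by_cases h1 : ∃ x, ∀ y, (x, y) ∈ T
  · have := eight_mul_card_le_of_full_line (fun x y => (x, y) ∈ T) T (by simp)
      (by simpa [ZMod.card] using hcard) h1
    rw [ZMod.card] at this
    change 8 * m ≤ 9 * a at this
    nlinarith
  by_cases h2 : ∃ y, ∀ x, (x, y) ∈ T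
  · have := eight_mul_card_le_of_full_line (fun y x => (x, y) ∈ T)
      (T.map (Equiv.prodComm _ _).toEmbedding) (by simp)
      (by simpa [ZMod.card] using hcard) h2
    rw [ZMod.card] at this
    change 8 * m ≤ 9 * b at this
    nlinarith
  push Not at h1 h2
  -- Without full lines every line meeting `T` is partial, so `T` lies in the product of its
  -- projections: `|T| ≤ a b ≤ ((a + b) / 2)^2`, while the boundary has at least `2 (a + b)` pushes.
  have hsub : T ⊆ (partialLines fun y x => (x, y) ∈ T) ×ˢ
      (partialLines fun x y => (x, y) ∈ T) := by
    rintro ⟨x, y⟩ hxy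
    rw [Finset.mem_product, mem_partialLines, mem_partialLines]
    exact ⟨⟨⟨y, hxy⟩, h1 x⟩, ⟨⟨x, hxy⟩, h2 y⟩⟩
  have h3 := Finset.card_le_card hsub
  rw [Finset.card_product] at h3
  change T.card ≤ b * a at h3
  zify at *
  nlinarith [sq_nonneg ((a : ℤ) - b)]

end Boundary

/-! ### The limiting ages of sets of nodes -/

section MeanAge

variable {m : ℕ} [NeZero m]

lemma card_compl_insert_lt {T : Finset (Node m)} {p : Node m × Dir} (hp : p ∈ boundary T) :
    (insert p.1 T)ᶜ.card < Tᶜ.card :=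
  Finset.card_lt_card (by
    rw [Finset.compl_ssubset_compl]
    exact Finset.ssubset_insert (mem_boundary.1 hp).1)

/-- The limiting mean version age of a set `T` of nodes, for `lamE = lam`. It is determined by
the ages of the sets that `T` can grow to. -/
noncomputable def meanAge (T : Finset (Node m)) : ℝ :=
  (1 + ∑ p : {p // p ∈ boundary T}, meanAge (insert p.1.1 T) / 4) /
    (T.card / (m : ℝ) ^ 2 + (boundary T).card / 4)
termination_by Tᶜ.card
decreasing_by exact card_compl_insert_lt p.2

/-- The stationary form of the differential equation, in units of `lamE / lam`. The recursion ends
at the full set, which has empty boundary and value `1`. For `T = ∅` the denominator vanishes and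
the value is the meaningless `0`; hence the nonemptiness hypotheses below. -/
lemma meanAge_eq (T : Finset (Node m)) :
    meanAge T = (1 + ∑ p ∈ boundary T, meanAge (insert p.1 T) / 4) /
      (T.card / (m : ℝ) ^ 2 + (boundary T).card / 4) := by
  rw [meanAge, Finset.sum_coe_sort (boundary T) fun p => meanAge (insert p.1 T) / 4]

/-- Induction from larger to smaller sets along boundary pushes. -/
lemma boundary_induction {motive : Finset (Node m) → Prop}
    (h : ∀ T, (∀ p ∈ boundary T, motive (insert p.1 T)) → motive T) (T : Finset (Node m)) :
    motive T := by
  induction hk : Tᶜ.card using Nat.strong_induction_on generalizing T with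
  | _ k ih =>
    subst hk
    exact h T fun p hp => ih _ (card_compl_insert_lt hp) _ rfl

/-- The recursion only sees the cardinality and the boundary, and both are compatible with
translations of the torus. -/
lemma meanAge_map_add (a : Node m) (T : Finset (Node m)) :
    meanAge (T.map (addRightEmbedding a)) = meanAge T := by
  induction T using boundary_induction with
  | h T ih =>
    have hb : boundary (T.map (addRightEmbedding a)) =
        (boundary T).map ((addRightEmbedding a).prodMap (Function.Embedding.refl Dir)) := by
      ext ⟨i, d⟩
      obtain ⟨j, rfl⟩ : ∃ j, i = j + a := ⟨i - a, by simp⟩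
      simp [mem_boundary, neighbor_add]
    rw [meanAge_eq, meanAge_eq T, hb, Finset.sum_map, Finset.card_map, Finset.card_map]
    congr 2
    refine Finset.sum_congr rfl fun p hp => ?_
    rw [← ih p hp, Finset.map_insert]
    rfl

lemma meanAge_singleton (i : Node m) : meanAge {i} = meanAge {(0 : Node m)} := by
  rw [← meanAge_map_add i {0}]
  simp

lemma meanAge_le_of_le {T : Finset (Node m)} (hT : T.Nonempty) {B : ℝ}
    (h : ∀ p ∈ boundary T, meanAge (insert p.1 T) ≤ B) :
    meanAge T ≤ (1 + (boundary T).card / 4 * B) /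
      (T.card / (m : ℝ) ^ 2 + (boundary T).card / 4) := by
  rw [meanAge_eq]
  have := Finset.sum_le_sum fun p hp =>
    div_le_div_of_nonneg_right (h p hp) (by norm_num : (0 : ℝ) ≤ 4)
  rw [Finset.sum_const, nsmul_eq_mul] at this
  gcongr
  linarith

lemma sq_pos_of_neZero : 0 < (m : ℝ) ^ 2 := by
  have := NeZero.pos m
  positivity

/-- The value `B = n / |T|` is a fixed point of the recursive bound: `(1 + b B) / (|T| / n + b) = B`
for every `b`. It bounds the larger sets as well, since it decreases in `|T|`. -/
lemma meanAge_le_div_card (T : Finset (Node m)) (hT : T.Nonempty) :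
    meanAge T ≤ (m : ℝ) ^ 2 / T.card := by
  induction T using boundary_induction with
  | h T ih =>
    have hm : 0 < (m : ℝ) ^ 2 := sq_pos_of_neZero
    have hc : 0 < (T.card : ℝ) := by exact_mod_cast hT.card_pos
    refine (meanAge_le_of_le hT (B := (m : ℝ) ^ 2 / T.card) fun p hp => ?_).trans ?_
    · refine (ih p hp (by simp)).trans ?_
      have : (T.card : ℝ) ≤ (insert p.1 T).card := by
        exact_mod_cast Finset.card_le_card (Finset.subset_insert _ _)
      gcongr
    · rw [div_le_iff₀ (by positivity)]
      have hm' : (m : ℝ) ≠ 0 := NeZero.ne _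
      apply le_of_eq
      field_simp

/-- If `B` bounds the sets with one more element and `q = |∂T| / 4`, then `(1 + q B) / (|T| / n + q)
≤ B + 1 / q`, and `q ≥ √|T|` by isoperimetry. The descent starts at size `J + 1` with
`meanAge_le_div_card`, so isoperimetry is only used up to size `J`. -/
lemma meanAge_le_add_sum (J : ℕ) (hJ : 9 * J ≤ m ^ 2) (T : Finset (Node m)) (hT : T.Nonempty)
    (hTJ : T.card ≤ J + 1) :
    meanAge T ≤ (m : ℝ) ^ 2 / (J + 1 : ℕ) + ∑ k ∈ Finset.Ico T.card (J + 1), 1 / √(k : ℝ) := by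
  induction T using boundary_induction with
  | h T ih =>
    rcases hTJ.eq_or_lt with h | h
    · simpa [h] using meanAge_le_div_card T hT
    set B : ℝ := (m : ℝ) ^ 2 / (J + 1 : ℕ) + ∑ k ∈ Finset.Ico (T.card + 1) (J + 1), 1 / √(k : ℝ)
    have hB : 0 ≤ B := by positivity
    have hm : 0 < (m : ℝ) ^ 2 := sq_pos_of_neZero
    have hc : 0 < (T.card : ℝ) := by exact_mod_cast hT.card_pos
    have hle := meanAge_le_of_le hT (B := B) fun p hp => by
      have hcard : (insert p.1 T).card = T.card + 1 :=
        Finset.card_insert_of_notMem (mem_boundary.1 hp).1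
      have := ih p hp (by simp) (by omega)
      rwa [hcard] at this
    have hiso : 4 * √(T.card : ℝ) ≤ (boundary T).card := by
      have h16 := sixteen_mul_card_le_card_boundary_sq T (by omega)
      have h16' : (16 : ℝ) * T.card ≤ ((boundary T).card : ℝ) ^ 2 := by exact_mod_cast h16
      refine abs_le_of_sq_le_sq' ?_ (by positivity) |>.2
      rw [mul_pow, Real.sq_sqrt hc.le]
      linarith
    have hs : 0 < √(T.card : ℝ) := Real.sqrt_pos.2 hc
    rw [Finset.sum_eq_sum_Ico_succ_bot h, ← add_assoc, add_right_comm]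
    refine hle.trans ?_
    change _ ≤ B + _
    rw [div_le_iff₀ (by positivity)]
    have h1 : 1 ≤ 1 / √(T.card : ℝ) * ((boundary T).card / 4) := by
      rw [one_div, ← div_eq_inv_mul, le_div_iff₀ hs]
      linarith
    have h2 : 0 ≤ (B + 1 / √(T.card : ℝ)) * (T.card / (m : ℝ) ^ 2) := by positivity
    linarith

lemma sum_one_div_sqrt_le (J : ℕ) :
    ∑ k ∈ Finset.Ico 1 (J + 1), 1 / √(k : ℝ) ≤ 2 * √(J : ℝ) := by
  induction J with
  | zero => simp
  | succ J ih =>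
    rw [Finset.sum_Ico_succ_top (by omega)]
    have h1 : 0 < √((J + 1 : ℕ) : ℝ) := Real.sqrt_pos.2 (by positivity)
    have h2 : √(J : ℝ) ^ 2 = J := Real.sq_sqrt (by positivity)
    have h3 : √((J + 1 : ℕ) : ℝ) ^ 2 = J + 1 := by rw [Real.sq_sqrt (by positivity)]; push_cast; rfl
    -- After multiplying by `√(J + 1)` this says `(√(J + 1) - √J)^2 ≥ 0`.
    have h4 : 1 / √((J + 1 : ℕ) : ℝ) ≤ 2 * √((J + 1 : ℕ) : ℝ) - 2 * √(J : ℝ) := by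
      rw [div_le_iff₀ h1]
      nlinarith [sq_nonneg (√((J + 1 : ℕ) : ℝ) - √(J : ℝ))]
    linarith

/-- The mean age of a single node is at most `3 n ^ (1 / 3)`. -/
lemma meanAge_singleton_le (hm : 27 ≤ m) (i : Node m) :
    meanAge {i} ≤ 3 * ((m : ℝ) ^ 2) ^ (1 / 3 : ℝ) := by
  have hm0 : (27 : ℝ) ≤ m := by exact_mod_cast hm
  set c : ℝ := ((m : ℝ) ^ 2) ^ (1 / 3 : ℝ) with hc
  have hc3 : c ^ 3 = (m : ℝ) ^ 2 := by
    rw [hc, ← Real.rpow_natCast, ← Real.rpow_mul (by positivity)]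
    norm_num
  have hc0 : 0 ≤ c := by positivity
  -- Since `27^2 = 9^3`, the threshold `27 ≤ m` is exactly `9 ≤ c`, which makes `J = ⌊c^2⌋` satisfy
  -- `9 J ≤ c^3 = n`.
  have hc9 : 9 ≤ c := by
    by_contra! h
    have : c ^ 3 < 9 ^ 3 := by gcongr
    nlinarith
  have hfl := Nat.floor_le (sq_nonneg c)
  have hfl' := Nat.lt_floor_add_one (c ^ 2)
  set J := ⌊c ^ 2⌋₊
  have hJ : 9 * J ≤ m ^ 2 := by
    have : (9 : ℝ) * J ≤ (m : ℝ) ^ 2 := by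
      rw [← hc3]
      nlinarith [sq_nonneg c]
    exact_mod_cast this
  have h := meanAge_le_add_sum J hJ {i} (by simp) (by simp)
  rw [Finset.card_singleton] at h
  have h2 := sum_one_div_sqrt_le J
  have h3 : √(J : ℝ) ≤ c := Real.sqrt_le_iff.2 ⟨hc0, hfl⟩
  have h4 : (m : ℝ) ^ 2 / (J + 1 : ℕ) ≤ c := by
    rw [div_le_iff₀ (by positivity), ← hc3]
    push_cast
    nlinarith
  linarith

end MeanAge

/-! ### Numerical bound -/

lemma Gamma_one_third_ge : 1.86 ≤ Real.Gamma (1 / 3) := by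
  have hG : Real.Gamma (4 / 3) = 1 / 3 * Real.Gamma (1 / 3) := by
    rw [← Real.Gamma_add_one (by norm_num)]
    norm_num
  have hpos : 0 < Real.Gamma (4 / 3) := Real.Gamma_pos_of_pos (by norm_num)
  -- Log-convexity at `2 = (3/5)(4/3) + (2/5) 3` gives `1 ≤ Γ(4/3)^3 * 2^2`, so `Γ(4/3) ≥ 4^(-1/3) >
  -- 0.62`.
  have h := Real.convexOn_log_Gamma.2 (show (4 / 3 : ℝ) ∈ Set.Ioi 0 by norm_num)
    (show (3 : ℝ) ∈ Set.Ioi 0 by norm_num) (show (0 : ℝ) ≤ 3 / 5 by norm_num)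
    (show (0 : ℝ) ≤ 2 / 5 by norm_num) (by norm_num)
  have h2 : Real.Gamma 2 = 1 := Real.Gamma_two
  have h3 : Real.Gamma 3 = 2 := by
    rw [show (3 : ℝ) = 2 + 1 by norm_num, Real.Gamma_add_one (by norm_num), h2, mul_one]
  norm_num [h2, h3] at h
  have h4 : 0 ≤ Real.log (Real.Gamma (4 / 3) ^ 3 * 2 ^ 2) := by
    rw [Real.log_mul (by positivity) (by norm_num), Real.log_pow, Real.log_pow]
    push_cast
    linarith
  have h5 : 1 ≤ Real.Gamma (4 / 3) ^ 3 * 2 ^ 2 := (Real.log_nonneg_iff (by positivity)).1 h4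
  by_contra! hlt
  have h6 : Real.Gamma (4 / 3) < 0.62 := by linarith
  have : Real.Gamma (4 / 3) ^ 3 < 0.62 ^ 3 := by gcongr
  norm_num at this
  linarith

/-- Crude bounds on the factors suffice: only `3 ≤ 2 β'` is needed to dominate the leading constant
`3`. -/
lemma three_halves_le_betaPrime : 3 / 2 ≤ betaPrime := by
  have h1 : 1.73 ≤ √3 := Real.le_sqrt_of_sq_le (by norm_num)
  have h2 : 0.66 ≤ Real.exp (-Real.eulerMascheroniConstant / 2) := by
    have := Real.add_one_le_exp (-Real.eulerMascheroniConstant / 2)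
    have := Real.eulerMascheroniConstant_lt_two_thirds
    linarith
  have h3 : 1.18 ≤ Real.exp (Real.pi ^ 2 / 48) := by
    have := Real.add_one_le_exp (Real.pi ^ 2 / 48)
    have := Real.pi_gt_three
    nlinarith
  have h4 : 0.66 ≤ (2 / 3 : ℝ) ^ (2 / 3 : ℝ) := by
    have := Real.rpow_le_rpow_of_exponent_ge (x := (2 / 3 : ℝ)) (y := 1) (z := 2 / 3)
      (by norm_num) (by norm_num) (by norm_num)
    rw [Real.rpow_one] at this
    linarith
  have h5 := Gamma_one_third_ge
  calc (3 / 2 : ℝ) ≤ 1.73 * 0.66 * 1.18 * 0.66 * 1.86 := by norm_num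
    _ ≤ betaPrime := by
      rw [betaPrime]
      gcongr

/-! ### Relaxation of a linear differential equation -/

lemma eventually_le_of_deriv_right {f f' : ℝ → ℝ} {c a ε : ℝ} (hc : 0 < c) (hε : 0 < ε)
    (hf : ContinuousOn f (Set.Ici a))
    (hf' : ∀ x, a ≤ x → HasDerivWithinAt f (f' x) (Set.Ici x) x)
    (bound : ∀ x, a ≤ x → f' x ≤ -c * f x + c * ε) :
    ∀ᶠ x in atTop, f x ≤ 2 * ε := by
  -- Gronwall with the negative constant `-c`; it only requires a right derivative.
  have hg : ∀ x, a ≤ x → f x ≤ (f a - ε) * Real.exp (-c * (x - a)) + ε := by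
    intro x hx
    have := le_gronwallBound_of_liminf_deriv_right_le (f := f) (f' := f') (δ := f a) (K := -c)
      (ε := c * ε) (a := a) (b := x) (hf.mono Set.Icc_subset_Ici_self)
      (fun y hy _ hr => (hf' y hy.1).liminf_right_slope_le hr)
      le_rfl (fun y hy => bound y hy.1) x ⟨hx, le_rfl⟩
    rw [gronwallBound_of_K_ne_0 (by linarith)] at this
    refine this.trans (le_of_eq ?_)
    field_simp
    ring
  have hlim : Tendsto (fun x => (f a - ε) * Real.exp (-c * (x - a)) + ε) atTop
      (𝓝 ((f a - ε) * 0 + ε)) := by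
    refine ((Real.tendsto_exp_atBot.comp ?_).const_mul _).add_const _
    exact (tendsto_atTop_add_const_right atTop (-a) tendsto_id).const_mul_atTop_of_neg (by linarith)
  filter_upwards [hlim.eventually_lt_const (show (f a - ε) * 0 + ε < 2 * ε by linarith),
    eventually_ge_atTop a] with x h1 h2
  exact (hg x h2).trans h1.le

/-- A solution of `f' = g - c f`, with one-sided derivative, tends to `L / c` if `g` tends to
`L`. -/
lemma tendsto_div_of_deriv_right {f g : ℝ → ℝ} {c L : ℝ} (hc : 0 < c)
    (hf : ContinuousOn f (Set.Ici 0))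
    (hf' : ∀ x, 0 ≤ x → HasDerivWithinAt f (g x - c * f x) (Set.Ici x) x)
    (hg : Tendsto g atTop (𝓝 L)) : Tendsto f atTop (𝓝 (L / c)) := by
  rw [Metric.tendsto_nhds]
  intro ε hε
  have h1 := hg.eventually (Metric.ball_mem_nhds L (show 0 < c * (ε / 4) by positivity))
  obtain ⟨a, ha⟩ := eventually_atTop.1 (h1.and (eventually_ge_atTop 0))
  have ha0 : 0 ≤ a := (ha a le_rfl).2
  have hLc : c * (L / c) = L := by field_simp
  have hab : ∀ x, a ≤ x → |g x - L| < c * (ε / 4) := fun x hx => by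
    simpa [Real.dist_eq] using (ha x hx).1
  have hup := eventually_le_of_deriv_right (f := fun x => f x - L / c) (a := a) (ε := ε / 4) hc
    (by positivity) ((hf.mono (Set.Ici_subset_Ici.2 ha0)).sub continuousOn_const)
    (fun x hx => (hf' x (ha0.trans hx)).sub_const _)
    (fun x hx => by
      have := (abs_lt.1 (hab x hx)).2
      linarith)
  have hlow := eventually_le_of_deriv_right (f := fun x => L / c - f x) (a := a) (ε := ε / 4) hc
    (by positivity) (continuousOn_const.sub (hf.mono (Set.Ici_subset_Ici.2 ha0)))
    (fun x hx => (hf' x (ha0.trans hx)).const_sub _)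
    (fun x hx => by
      have := (abs_lt.1 (hab x hx)).1
      linarith)
  filter_upwards [hup, hlow] with x h1 h2
  rw [Real.dist_eq, abs_lt]
  constructor <;> linarith

/-- A function whose increments agree to second order with those of an affine flow, locally
uniformly, is continuous and has the right derivative prescribed by the flow. -/
lemma continuousOn_and_hasDerivWithinAt_of_step {F D : ℝ → ℝ} {R a : ℝ} (hR : 0 ≤ R)
    (hF : ∀ x, 0 ≤ x → |F x| ≤ a * (1 + x)) (hD : ∀ x, 0 ≤ x → |D x| ≤ a * (1 + x))
    (hstep : ∀ x h, 0 ≤ x → 0 ≤ h →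
      |F (x + h) - Real.exp (-(R * h)) * (F x + h * D x)| ≤ a * (1 + x) * h ^ 2) :
    ContinuousOn F (Set.Ici 0) ∧
      ∀ x, 0 ≤ x → HasDerivWithinAt F (D x - R * F x) (Set.Ici x) x := by
  have ha : 0 ≤ a := by simpa using (abs_nonneg _).trans (hF 0 le_rfl)
  constructor
  -- A right derivative alone would not give continuity from the left; the local uniformity of the
  -- step estimate gives a Lipschitz bound on `[0, b]`.
  · have key : ∀ b, 0 ≤ b → ∀ x y, 0 ≤ x → x ≤ y → y ≤ b →
        |F y - F x| ≤ (R * (a * (1 + b)) + a * (1 + b) + a * (1 + b) * b) * (y - x) := by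
      intro b hb x y hx hxy hyb
      obtain ⟨h, rfl⟩ : ∃ h, y = x + h := ⟨y - x, by ring⟩
      have hh : 0 ≤ h := by linarith
      have hxb : a * (1 + x) ≤ a * (1 + b) := by gcongr; linarith
      have h1 := hstep x h hx hh
      have he1 : Real.exp (-(R * h)) ≤ 1 := Real.exp_le_one_iff.2 (by nlinarith)
      have he2 : 1 - R * h ≤ Real.exp (-(R * h)) := by
        linarith [Real.add_one_le_exp (-(R * h))]
      have he0 := Real.exp_pos (-(R * h))
      have h2 : |(Real.exp (-(R * h)) - 1) * F x| ≤ R * h * (a * (1 + b)) := by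
        rw [abs_mul]
        gcongr
        · rw [abs_le]; constructor <;> nlinarith
        · exact (hF x hx).trans hxb
      have h3 : |Real.exp (-(R * h)) * (h * D x)| ≤ 1 * (h * (a * (1 + b))) := by
        rw [abs_mul, abs_mul, abs_of_pos he0, abs_of_nonneg hh]
        gcongr
        exact (hD x hx).trans hxb
      have h4 : a * (1 + x) * h ^ 2 ≤ a * (1 + b) * (b * h) := by
        rw [sq]
        gcongr
        linarith
      calc |F (x + h) - F x| = |(F (x + h) - Real.exp (-(R * h)) * (F x + h * D x)) +
            ((Real.exp (-(R * h)) - 1) * F x + Real.exp (-(R * h)) * (h * D x))| := by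
              congr 1; ring
        _ ≤ _ := abs_add_le _ _
        _ ≤ a * (1 + b) * (b * h) + (R * h * (a * (1 + b)) + 1 * (h * (a * (1 + b)))) :=
          add_le_add (h1.trans h4) ((abs_add_le _ _).trans (add_le_add h2 h3))
        _ = _ := by ring
    intro x hx
    have hx0 : 0 ≤ x := hx
    have hb : 0 ≤ x + 1 := by linarith
    have hC : 0 ≤ R * (a * (1 + (x + 1))) + a * (1 + (x + 1)) + a * (1 + (x + 1)) * (x + 1) := by
      positivity
    have hlip : LipschitzOnWith ⟨_, hC⟩ F (Set.Icc 0 (x + 1)) := by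
      refine LipschitzOnWith.of_dist_le_mul fun y hy z hz => ?_
      simp only [Real.dist_eq]
      rcases le_total y z with h | h
      · rw [abs_sub_comm (F y), abs_sub_comm y, abs_of_nonneg (sub_nonneg.2 h)]
        exact key _ hb y z hy.1 h hz.2
      · rw [abs_of_nonneg (sub_nonneg.2 h)]
        exact key _ hb z y hz.1 h hy.2
    refine (hlip.continuousOn x ⟨hx, by linarith⟩).mono_of_mem_nhdsWithin ?_
    rw [← Set.Ici_inter_Iic]
    exact inter_mem_nhdsWithin _ (Iic_mem_nhds (by linarith))
  · intro x hx
    have h1 : HasDerivWithinAt (fun y => Real.exp (-(R * (y - x))) * (F x + (y - x) * D x))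
        (D x - R * F x) (Set.Ici x) x := by
      have hid : HasDerivAt (fun y : ℝ => y - x) 1 x := (hasDerivAt_id x).sub_const x
      have := ((hid.const_mul R).neg.exp).mul ((hid.mul_const (D x)).const_add (F x))
      refine this.hasDerivWithinAt.congr_deriv ?_
      simp
      ring
    have h2 : HasDerivWithinAt
        (fun y => F y - Real.exp (-(R * (y - x))) * (F x + (y - x) * D x)) 0 (Set.Ici x) x := by
      have hO : (fun y => F y - Real.exp (-(R * (y - x))) * (F x + (y - x) * D x))
          =O[𝓝[Set.Ici x] x] fun y => ‖y - x‖ ^ 2 := by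
        refine IsBigO.of_bound (a * (1 + x)) ?_
        filter_upwards [self_mem_nhdsWithin] with y hy
        have := hstep x (y - x) hx (sub_nonneg.2 hy)
        rw [add_sub_cancel] at this
        simpa using this
      simpa using (hO.hasFDerivWithinAt (𝕜 := ℝ) Set.self_mem_Ici (by norm_num)).hasDerivWithinAt
    have := h1.add h2
    rw [add_zero] at this
    refine this.congr_of_mem (fun y _ => ?_) Set.self_mem_Ici
    simp

/-! ### Mean of the Poisson distribution -/

lemma hasSum_poisson_mul (r : ℝ≥0) :
    HasSum (fun n : ℕ => Real.exp (-r) * (r : ℝ) ^ n / n.factorial * n) r := by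
  have h := (hasSum_one_poissonMeasure r).mul_left (r : ℝ)
  rw [← hasSum_nat_add_iff' 1]
  simp only [Finset.sum_range_one, Nat.cast_zero, mul_zero, sub_zero]
  rw [mul_one] at h
  refine h.congr_fun fun n => ?_
  rw [Nat.factorial_succ]
  push_cast
  have h1 : (n.factorial : ℝ) ≠ 0 := by positivity
  have h2 : (n : ℝ) + 1 ≠ 0 := by positivity
  field_simp
  ring

lemma integrable_cast_poissonMeasure (r : ℝ≥0) :
    Integrable (fun n : ℕ => (n : ℝ)) (poissonMeasure r) := by
  rw [integrable_poissonMeasure_iff]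
  simpa using (hasSum_poisson_mul r).summable

lemma integral_cast_poissonMeasure (r : ℝ≥0) :
    ∫ n : ℕ, (n : ℝ) ∂(poissonMeasure r) = r := by
  rw [integral_poissonMeasure]
  exact (hasSum_poisson_mul r).tsum_eq

/-! ### The chain of states along a sequence of event counts -/

/-- A state: the version at the source and the versions at the nodes. -/
abbrev State (m : ℕ) : Type := ℕ × (Node m → ℕ)

section Chain

variable {m : ℕ}

/-- The event counts of a time interval with at most one event. -/
def smallCount : Option (Event m) → Event m → ℕ
  | none => 0
  | some e => Pi.single e 1

lemma smallCount_injective : Function.Injective (smallCount (m := m)) := by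
  have h0 : ∀ e : Event m, smallCount (some e) e = 1 := fun e => Pi.single_eq_same e 1
  rintro (_ | e) (_ | e') h
  · rfl
  · have := congrFun h e'
    rw [h0] at this
    simp [smallCount] at this
  · have := congrFun h e
    rw [h0] at this
    simp [smallCount] at this
  · have := congrFun h e
    rw [h0] at this
    by_contra hne
    have hne' : e ≠ e' := fun h => hne (by rw [h])
    simp [smallCount, Pi.single_eq_of_ne hne'] at this

/-- The effect on the state of at most one event. -/
def advance (x : State m) : Option (Event m) → State m
  | none => x
  | some e => (x.1 + smallCount (some e) Event.update, step x.1 x.2 e)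

open Classical in
/-- The effect on the state of a time interval with given event counts; the versions of the nodes
are left unchanged if there is more than one event. -/
noncomputable def transition (x : State m) (z : Event m → ℕ) : State m :=
  if h : ∃ o, z = smallCount o then advance x h.choose else (x.1 + z Event.update, x.2)

/-- Injectivity of `smallCount` makes the choice in `transition` immaterial. -/
lemma transition_smallCount (x : State m) (o : Option (Event m)) :
    transition x (smallCount o) = advance x o := by
  have h : ∃ o', smallCount o = smallCount o' := ⟨o, rfl⟩
  rw [transition, dif_pos h, ← smallCount_injective h.choose_spec]

/-- The source coordinate is exact even when there are several events, so `chain` is dominated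
independently of the grid. -/
lemma transition_fst (x : State m) (z : Event m → ℕ) :
    (transition x z).1 = x.1 + z Event.update := by
  by_cases h : ∃ o, z = smallCount o
  · obtain ⟨o, rfl⟩ := h
    rw [transition_smallCount]
    cases o <;> simp [advance, smallCount]
  · rw [transition, dif_neg h]

/-- No node is ahead of the source. -/
def IsValid (x : State m) : Prop := ∀ i, x.2 i ≤ x.1

lemma IsValid.advance {x : State m} (hx : IsValid x) (o : Option (Event m)) :
    IsValid (advance x o) := by
  intro j
  have hx' := fun i => (hx i).trans (Nat.le_add_right x.1
    (match o with | none => 0 | some e => smallCount (some e) Event.update))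
  rcases o with _ | _ | i | ⟨i, d⟩
  · exact hx j
  · exact hx' j
  · simp only [Gossip.advance, step, Function.update_apply]
    split_ifs
    · exact Nat.le_add_right _ _
    · exact hx' j
  · simp only [Gossip.advance, step, Function.update_apply]
    split_ifs
    · exact max_le (hx' _) (hx' _)
    · exact hx' j

lemma IsValid.transition {x : State m} (hx : IsValid x) (z : Event m → ℕ) :
    IsValid (transition x z) := by
  by_cases h : ∃ o, z = smallCount o
  · obtain ⟨o, rfl⟩ := h
    rw [transition_smallCount]
    exact hx.advance o
  · rw [Gossip.transition, dif_neg h]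
    exact fun i => (hx i).trans (Nat.le_add_right _ _)

/-- The states reached from the zero state after consecutive time intervals with given event
counts. -/
noncomputable def chain (z : ℕ → Event m → ℕ) : ℕ → State m
  | 0 => (0, 0)
  | k + 1 => transition (chain z k) (z k)

lemma chain_congr {z z' : ℕ → Event m → ℕ} {k : ℕ} (h : ∀ i < k, z i = z' i) :
    chain z k = chain z' k := by
  induction k with
  | zero => rfl
  | succ k ih => rw [chain, chain, ih fun i hi => h i (by omega), h k (by omega)]

lemma isValid_chain (z : ℕ → Event m → ℕ) (k : ℕ) : IsValid (chain z k) := by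
  induction k with
  | zero => intro i; simp [chain]
  | succ k ih => exact ih.transition _

/-- The version age of a set of nodes in a given state. -/
def stateAge (T : Finset (Node m)) (x : State m) : ℝ := (x.1 : ℝ) - (T.sup x.2 : ℕ)

lemma stateAge_nonneg (T : Finset (Node m)) {x : State m} (hx : IsValid x) : 0 ≤ stateAge T x := by
  have : T.sup x.2 ≤ x.1 := Finset.sup_le fun i _ => hx i
  rw [stateAge, sub_nonneg]
  exact_mod_cast this

lemma stateAge_le (T : Finset (Node m)) (x : State m) : stateAge T x ≤ x.1 := by
  rw [stateAge, sub_le_self_iff]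
  positivity

lemma stateAge_advance_update (T : Finset (Node m)) (x : State m) :
    stateAge T (advance x (some Event.update)) = stateAge T x + 1 := by
  simp [stateAge, advance, smallCount, step]
  ring

lemma smallCount_send (i : Node m) : smallCount (some (Event.send i)) Event.update = 0 :=
  Pi.single_eq_of_ne (by simp) _

lemma smallCount_push (i : Node m) (d : Dir) :
    smallCount (some (Event.push i d)) Event.update = 0 :=
  Pi.single_eq_of_ne (by simp) _

lemma sup_update_of_notMem {T : Finset (Node m)} {i : Node m} (h : i ∉ T) (f : Node m → ℕ)
    (a : ℕ) : T.sup (Function.update f i a) = T.sup f :=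
  Finset.sup_congr rfl fun j hj => Function.update_of_ne (by rintro rfl; exact h hj) _ _

/-- Validity is needed for the received source version to be the newest one in `T`. -/
lemma stateAge_advance_send (T : Finset (Node m)) {x : State m} (hx : IsValid x) (i : Node m) :
    stateAge T (advance x (some (Event.send i))) = if i ∈ T then 0 else stateAge T x := by
  simp only [stateAge, advance, smallCount_send, step, add_zero]
  split_ifs with h
  · have : T.sup (Function.update x.2 i x.1) = x.1 := by
      refine le_antisymm (Finset.sup_le fun j _ => ?_) ?_
      · rw [Function.update_apply]
        split_ifs
        · exact le_rfl
        · exact hx j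
      · simpa using Finset.le_sup (f := Function.update x.2 i x.1) h
    rw [this, sub_self]
  · rw [sup_update_of_notMem h]

/-- This identity closes the system of mean ages: after a push into `T`, the newest version in `T`
is the newest one that was in `insert i T`. -/
lemma stateAge_advance_push (T : Finset (Node m)) (x : State m) (i : Node m) (d : Dir) :
    stateAge T (advance x (some (Event.push i d))) =
      if neighbor i d ∈ T then stateAge (insert i T) x else stateAge T x := by
  simp only [stateAge, advance, smallCount_push, step, add_zero]
  split_ifs with h
  · congr 2
    set j := neighbor i d
    rw [Finset.sup_insert]
    apply le_antisymm
    · refine Finset.sup_le fun k hk => ?_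
      rw [Function.update_apply]
      split_ifs
      · exact max_le (le_sup_of_le_right (Finset.le_sup h)) le_sup_left
      · exact le_sup_of_le_right (Finset.le_sup hk)
    · have hj := Finset.le_sup (f := Function.update x.2 j (max (x.2 j) (x.2 i))) h
      rw [Function.update_self] at hj
      refine sup_le ((le_max_right _ _).trans hj) (Finset.sup_le fun k hk => ?_)
      refine le_trans ?_ (Finset.le_sup (f := Function.update x.2 j (max (x.2 j) (x.2 i))) hk)
      rw [Function.update_apply]
      split_ifs with hkj
      · rw [hkj]; exact le_max_left _ _
      · exact le_rfl
  · rw [sup_update_of_notMem h]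

end Chain

/-! ### Event counts of a gossip process -/

section Gossiping

variable {Ω : Type*} [MeasurableSpace Ω] {P : Measure Ω} {m : ℕ} {lamE lam : ℝ≥0}
  {N : Event m → ℝ≥0 → Ω → ℕ} {K : ℝ≥0 → Ω → Node m → ℕ}

/-- The numbers of events in the time interval `(s, t]`. -/
def counts (N : Event m → ℝ≥0 → Ω → ℕ) (s t : ℝ≥0) (ω : Ω) (e : Event m) : ℕ :=
  N e t ω - N e s ω

/-- The state of the network at time `t`. -/
def state (N : Event m → ℝ≥0 → Ω → ℕ) (K : ℝ≥0 → Ω → Node m → ℕ) (t : ℝ≥0) (ω : Ω) : State m :=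
  (N Event.update t ω, K t ω)

namespace IsGossipProcess

lemma measurable_counts (hG : IsGossipProcess P m lamE lam N K) (s t : ℝ≥0) :
    Measurable (counts N s t) :=
  measurable_pi_lambda _ fun e => ((hG.poisson e).measurable t).sub ((hG.poisson e).measurable s)

/-- Independence across clocks combines with independence of the increments of each clock into joint
independence over all pairs of an event and an interval. -/
lemma iIndepFun_counts (hG : IsGossipProcess P m lamE lam N K) {τ : ℕ → ℝ≥0} (hτ : Monotone τ) :
    iIndepFun (fun (p : Event m × ℕ) ω => counts N (τ p.2) (τ (p.2 + 1)) ω p.1) P := by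
  have := hG.indep.isProbabilityMeasure
  refine iIndepFun_uncurry' (X := fun e k ω => counts N (τ k) (τ (k + 1)) ω e)
    (fun e k => ((hG.poisson e).measurable _).sub ((hG.poisson e).measurable _)) ?_
    fun e => (hG.poisson e).indepIncrements.nat hτ
  exact hG.indep.comp (fun _ (n : ℝ≥0 → ℕ) (k : ℕ) => n (τ (k + 1)) - n (τ k)) fun _ =>
    measurable_pi_lambda _ fun k => (measurable_pi_apply _).sub (measurable_pi_apply _)

/-- The state of the chain is independent of the event counts of the next interval. -/
lemma indepFun_chain_counts [NeZero m] (hG : IsGossipProcess P m lamE lam N K) {τ : ℕ → ℝ≥0}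
    (hτ : Monotone τ) (k : ℕ) :
    IndepFun (fun ω => chain (fun i => counts N (τ i) (τ (i + 1)) ω) k)
      (counts N (τ k) (τ (k + 1))) P := by
  classical
  let A : Finset (Event m × ℕ) := Finset.univ ×ˢ Finset.range k
  let B : Finset (Event m × ℕ) := Finset.univ ×ˢ {k}
  have hAB : Disjoint A B := by
    rw [Finset.disjoint_left]
    rintro ⟨e, i⟩ h1 h2
    simp [A, B] at h1 h2
    omega
  have h := (hG.iIndepFun_counts hτ).indepFun_finset A B hAB fun p =>
    ((hG.poisson p.1).measurable _).sub ((hG.poisson p.1).measurable _)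
  -- The chain reads only the intervals before `k`, so the extension by `0` outside `A` is harmless.
  let φ : (A → ℕ) → State m := fun w =>
    chain (fun i e => if h : (e, i) ∈ A then w ⟨(e, i), h⟩ else 0) k
  let ψ : (B → ℕ) → Event m → ℕ := fun w e => w ⟨(e, k), by simp [B]⟩
  convert h.comp (φ := φ) (ψ := ψ) (Measurable.of_discrete) (Measurable.of_discrete) using 1
  swap
  · rfl
  funext ω
  refine chain_congr fun i hi => ?_
  funext e
  simp [A, hi]

lemma counts_mean [NeZero m] (hG : IsGossipProcess P m lamE lam N K) (t : ℝ≥0) :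
    Integrable (fun ω => (N Event.update t ω : ℝ)) P ∧
      ∫ ω, (N Event.update t ω : ℝ) ∂P = lamE * t := by
  have hp := hG.poisson Event.update
  have hlaw := hp.law 0 t (zero_le)
  have heq : N Event.update t =ᵐ[P] fun ω => N Event.update t ω - N Event.update 0 ω := by
    filter_upwards [hp.start] with ω hω
    rw [hω, Nat.sub_zero]
  have hl := hlaw.congr heq
  have hi := integrable_cast_poissonMeasure (rate m lamE lam Event.update * (t - 0))
  constructor
  · rw [← hl.map_eq] at hi
    exact hi.comp_measurable (hp.measurable t)
  · have := hl.integral_comp (f := fun n : ℕ => (n : ℝ)) (by fun_prop)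
    have h2 := integral_cast_poissonMeasure (rate m lamE lam Event.update * (t - 0))
    rw [← this] at h2
    simpa [rate, Function.comp_def] using h2

end IsGossipProcess

/-- The total rate of all events. -/
noncomputable def totalRate (m : ℕ) [NeZero m] (lamE lam : ℝ≥0) : ℝ≥0 :=
  ∑ e : Event m, rate m lamE lam e

/-- The weight of at most one event in a time interval of length `h`. -/
noncomputable def weight (m : ℕ) (lamE lam : ℝ≥0) (h : ℝ≥0) : Option (Event m) → ℝ
  | none => 1
  | some e => rate m lamE lam e * h

lemma sum_weight [NeZero m] (h : ℝ≥0) :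
    ∑ o, weight m lamE lam h o = 1 + totalRate m lamE lam * h := by
  rw [Fintype.sum_option]
  simp [weight, totalRate, Finset.sum_mul]

namespace IsGossipProcess

lemma measureReal_counts [NeZero m] (hG : IsGossipProcess P m lamE lam N K) (s h : ℝ≥0)
    (o : Option (Event m)) :
    P.real {ω | counts N s (s + h) ω = smallCount o} =
      Real.exp (-(totalRate m lamE lam * h)) * weight m lamE lam h o := by
  have hind : iIndepFun (fun e ω => counts N s (s + h) ω e) P :=
    hG.indep.comp (fun _ (n : ℝ≥0 → ℕ) => n (s + h) - n s) fun _ =>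
      (measurable_pi_apply _).sub (measurable_pi_apply _)
  have hset : {ω | counts N s (s + h) ω = smallCount o} =
      ⋂ e ∈ (Finset.univ : Finset (Event m)),
        (fun ω => counts N s (s + h) ω e) ⁻¹' {smallCount o e} := by
    ext ω
    simp [funext_iff]
  have h1 : ∀ e, P.real ((fun ω => counts N s (s + h) ω e) ⁻¹' {smallCount o e}) =
      Real.exp (-(rate m lamE lam e * h)) * ((rate m lamE lam e * h : ℝ) ^ smallCount o e /
        (smallCount o e).factorial) := by
    intro e
    have := ((hG.poisson e).law s (s + h) (by simp)).measureReal_eq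
      (p := fun n => n = smallCount o e) (MeasurableSet.of_discrete)
    rw [Set.ofPred_eq_eq_singleton, poissonMeasure_real_singleton] at this
    rw [add_tsub_cancel_left] at this
    rw [mul_div_assoc']
    exact_mod_cast this
  rw [hset, measureReal_def, hind.measure_inter_preimage_eq_mul _ (by simp),
    ENNReal.toReal_prod]
  simp_rw [← measureReal_def, h1]
  rw [Finset.prod_mul_distrib, ← Real.exp_sum]
  congr 1
  · rw [Finset.sum_neg_distrib, ← Finset.sum_mul, totalRate]
    push_cast
    rfl
  · rcases o with _ | e
    · simp [smallCount, weight]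
    · rw [Finset.prod_eq_single e]
      · simp [smallCount, weight]
      · intro b _ hb
        simp [smallCount, Pi.single_eq_of_ne hb]
      · simp

/-- The probability of more than one event in a short time interval. -/
lemma measureReal_bad_le [NeZero m] (hG : IsGossipProcess P m lamE lam N K) (s h : ℝ≥0) :
    P.real {ω | ∀ o, counts N s (s + h) ω ≠ smallCount o} ≤ (totalRate m lamE lam * h) ^ 2 := by
  have := hG.indep.isProbabilityMeasure
  have hmeas : ∀ o, MeasurableSet {ω | counts N s (s + h) ω = smallCount o} := fun o =>
    hG.measurable_counts s (s + h) (MeasurableSet.of_discrete (s := {smallCount o}))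
  have hU : P.real (⋃ o, {ω | counts N s (s + h) ω = smallCount o}) =
      ∑ o, P.real {ω | counts N s (s + h) ω = smallCount o} := by
    rw [measureReal_iUnion_fintype _ hmeas]
    intro o o' hoo
    rw [Function.onFun, Set.disjoint_left]
    intro ω h1 h2
    exact hoo (smallCount_injective (h1.symm.trans h2))
  have hc : {ω | ∀ o, counts N s (s + h) ω ≠ smallCount o} =
      (⋃ o, {ω | counts N s (s + h) ω = smallCount o})ᶜ := by
    ext ω
    simp
  rw [hc, probReal_compl_eq_one_sub (MeasurableSet.iUnion hmeas), hU]
  simp_rw [hG.measureReal_counts, ← Finset.mul_sum, sum_weight]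
  set x : ℝ := totalRate m lamE lam * h
  have hx : 0 ≤ x := by positivity
  -- The probability is `1 - exp (-x) (1 + x) ≤ 1 - (1 - x)(1 + x) = x^2`.
  have := Real.add_one_le_exp (-x)
  nlinarith

end IsGossipProcess

end Gossiping

/-! ### Approximation of the state by the chain of a fine grid -/

/-- The dyadic grid of mesh `s / 2 ^ j` in `[0, s]`, followed by the time `t`. -/
noncomputable def grid (s t : ℝ≥0) (j i : ℕ) : ℝ≥0 := if i ≤ 2 ^ j then s * (i / 2 ^ j) else t

lemma monotone_grid {s t : ℝ≥0} (hst : s ≤ t) (j : ℕ) : Monotone (grid s t j) := by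
  intro a b hab
  rw [grid, grid]
  split_ifs with h1 h2 h2
  · gcongr
  · refine le_trans (mul_le_of_le_one_right zero_le ?_) hst
    rw [div_le_one₀ (by positivity)]
    exact_mod_cast h1
  · omega
  · exact le_rfl

lemma grid_zero (s t : ℝ≥0) (j : ℕ) : grid s t j 0 = 0 := by simp [grid]

lemma grid_two_pow (s t : ℝ≥0) (j : ℕ) : grid s t j (2 ^ j) = s := by simp [grid]

lemma grid_two_pow_add_one (s t : ℝ≥0) (j : ℕ) : grid s t j (2 ^ j + 1) = t := by simp [grid]

lemma grid_add_one (s t : ℝ≥0) {j i : ℕ} (hi : i < 2 ^ j) :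
    grid s t j (i + 1) = grid s t j i + s / 2 ^ j := by
  rw [grid, grid, if_pos (by omega), if_pos hi.le]
  push_cast
  ring

section Gossiping

variable {Ω : Type*} {m : ℕ} {lamE lam : ℝ≥0} {N : Event m → ℝ≥0 → Ω → ℕ} {K : ℝ≥0 → Ω → Node m → ℕ}

/-- The almost sure properties of the paths of a gossip process. -/
structure IsRegularPath (N : Event m → ℝ≥0 → Ω → ℕ) (K : ℝ≥0 → Ω → Node m → ℕ) (ω : Ω) :
    Prop where
  mono : Monotone fun t => N Event.update t ω
  start : state N K 0 ω = (0, 0)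
  advance : ∀ s t o, s ≤ t → counts N s t ω = smallCount o →
    state N K t ω = advance (state N K s ω) o

lemma IsRegularPath.chain_fst {ω : Ω} (hω : IsRegularPath N K ω) {τ : ℕ → ℝ≥0} (hτ : Monotone τ)
    (h0 : τ 0 = 0) (k : ℕ) :
    (chain (fun i => counts N (τ i) (τ (i + 1)) ω) k).1 = N Event.update (τ k) ω := by
  induction k with
  | zero => rw [h0]; exact (congrArg Prod.fst hω.start).symm
  | succ k ih =>
    rw [chain, transition_fst, ih, counts]
    exact Nat.add_sub_cancel' (hω.mono (hτ k.le_succ))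

lemma IsRegularPath.chain_eq {ω : Ω} (hω : IsRegularPath N K ω) {τ : ℕ → ℝ≥0} (hτ : Monotone τ)
    (h0 : τ 0 = 0) {k : ℕ} (hk : ∀ i < k, ∃ o, counts N (τ i) (τ (i + 1)) ω = smallCount o) :
    chain (fun i => counts N (τ i) (τ (i + 1)) ω) k = state N K (τ k) ω := by
  induction k with
  | zero => rw [h0]; exact hω.start.symm
  | succ k ih =>
    obtain ⟨o, ho⟩ := hk k k.lt_succ_self
    rw [chain, ih fun i hi => hk i (by omega), ho, transition_smallCount,
      hω.advance _ _ o (hτ k.le_succ) ho]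

namespace IsGossipProcess

variable [MeasurableSpace Ω] {P : Measure Ω} [NeZero m]

lemma ae_isRegularPath (hG : IsGossipProcess P m lamE lam N K) :
    ∀ᵐ ω ∂P, IsRegularPath N K ω := by
  filter_upwards [ae_all_iff.2 fun e => (hG.poisson e).mono, (hG.poisson Event.update).start,
    hG.start, hG.rest, hG.jump] with ω hmono hN hK hrest hjump
  refine ⟨hmono _, Prod.ext hN (funext hK), fun s t o hst ho => ?_⟩
  have hadd : ∀ e, N e t ω = N e s ω + smallCount o e := fun e => by
    rw [← ho, counts]
    exact (Nat.add_sub_cancel' (hmono e hst)).symm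
  rcases o with _ | e
  · exact Prod.ext (hadd _) (hrest s t hst hadd)
  · refine Prod.ext (hadd _) (hjump s t e hst ?_ fun e' he' => ?_)
    · rw [hadd, smallCount, Pi.single_eq_same]
    · rw [hadd, smallCount, Pi.single_eq_of_ne he', add_zero]

/-- Almost surely, the cells of all sufficiently fine grids contain at most one event each. -/
lemma ae_eventually_chain_eq (hG : IsGossipProcess P m lamE lam N K) {s t : ℝ≥0} (hst : s ≤ t) :
    ∀ᵐ ω ∂P, ∀ᶠ j in atTop,
      chain (fun i => counts N (grid s t j i) (grid s t j (i + 1)) ω) (2 ^ j) =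
        state N K s ω := by
  have := hG.indep.isProbabilityMeasure
  let bad : ℕ → Set Ω := fun j => ⋃ i ∈ Finset.range (2 ^ j),
    {ω | ∀ o, counts N (grid s t j i) (grid s t j (i + 1)) ω ≠ smallCount o}
  set x : ℝ := totalRate m lamE lam * s
  -- There are `2^j` cells, each bad with probability at most `(x / 2^j)^2`; the total is summable
  -- in `j`, and Borel–Cantelli applies.
  have hbad : ∀ j, P (bad j) ≤ ENNReal.ofReal (x ^ 2 * (1 / 2) ^ j) := by
    intro j
    rw [← ofReal_measureReal (measure_ne_top P _)]
    apply ENNReal.ofReal_le_ofReal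
    calc P.real (bad j) ≤ ∑ i ∈ Finset.range (2 ^ j),
          P.real {ω | ∀ o, counts N (grid s t j i) (grid s t j (i + 1)) ω ≠ smallCount o} :=
        measureReal_biUnion_finset_le _ _
      _ ≤ ∑ i ∈ Finset.range (2 ^ j), (x / 2 ^ j) ^ 2 := by
        refine Finset.sum_le_sum fun i hi => ?_
        rw [grid_add_one s t (Finset.mem_range.1 hi)]
        refine (hG.measureReal_bad_le _ _).trans (le_of_eq ?_)
        push_cast
        rw [mul_div_assoc]
      _ = x ^ 2 * (1 / 2) ^ j := by
        rw [Finset.sum_const, Finset.card_range, nsmul_eq_mul, one_div, inv_pow]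
        push_cast
        field_simp
  have hsum : ∑' j, P (bad j) ≠ ⊤ := by
    refine ne_top_of_le_ne_top ?_ (ENNReal.tsum_le_tsum hbad)
    exact (summable_geometric_two.mul_left _).tsum_ofReal_ne_top
  filter_upwards [ae_eventually_notMem hsum, hG.ae_isRegularPath] with ω hω hreg
  filter_upwards [hω] with j hj
  rw [hreg.chain_eq (monotone_grid hst j) (grid_zero s t j), grid_two_pow]
  intro i hi
  by_contra! h
  exact hj (Set.mem_biUnion (Finset.mem_coe.2 (Finset.mem_range.2 hi)) h)

/-- Validity is not among the axioms of a gossip process; it is inherited from the approximating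
chains. -/
lemma ae_isValid (hG : IsGossipProcess P m lamE lam N K) (s : ℝ≥0) :
    ∀ᵐ ω ∂P, IsValid (state N K s ω) := by
  filter_upwards [hG.ae_eventually_chain_eq (le_refl s)] with ω hω
  obtain ⟨j, hj⟩ := hω.exists
  rw [← hj]
  exact isValid_chain _ _

lemma measurable_chain (hG : IsGossipProcess P m lamE lam N K) (τ : ℕ → ℝ≥0) (k : ℕ) :
    Measurable fun ω => chain (fun i => counts N (τ i) (τ (i + 1)) ω) k := by
  induction k with
  | zero => exact measurable_const
  | succ k ih =>
    have h2 : Measurable fun p : State m × (Event m → ℕ) => transition p.1 p.2 :=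
      Measurable.of_discrete
    exact h2.comp (ih.prodMk (hG.measurable_counts _ _))

/-- No measurability of `K` is assumed; it comes from the almost sure limit of measurable chains. -/
lemma aemeasurable_comp_state (hG : IsGossipProcess P m lamE lam N K) (φ : State m → ℝ)
    (s : ℝ≥0) : AEMeasurable (fun ω => φ (state N K s ω)) P := by
  refine aemeasurable_of_tendsto_metrizable_ae atTop (f := fun j ω =>
      φ (chain (fun i => counts N (grid s s j i) (grid s s j (i + 1)) ω) (2 ^ j)))
    (fun j => (Measurable.of_discrete.comp (hG.measurable_chain _ _)).aemeasurable) ?_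
  filter_upwards [hG.ae_eventually_chain_eq (le_refl s)] with ω hω
  exact tendsto_const_nhds.congr' (by filter_upwards [hω] with j hj; rw [hj])

lemma integrable_comp_state (hG : IsGossipProcess P m lamE lam N K) {φ : State m → ℝ} {C : ℝ}
    (hφ : ∀ x, IsValid x → |φ x| ≤ x.1 + C) (s : ℝ≥0) :
    Integrable (fun ω => φ (state N K s ω)) P := by
  have := hG.indep.isProbabilityMeasure
  refine Integrable.mono' ((hG.counts_mean s).1.add (integrable_const C))
    (hG.aemeasurable_comp_state φ s).aestronglyMeasurable ?_
  filter_upwards [hG.ae_isValid s] with ω hω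
  exact hφ _ hω

lemma measurableSet_counts_eq (hG : IsGossipProcess P m lamE lam N K) (s t : ℝ≥0)
    (c : Event m → ℕ) : MeasurableSet {ω | counts N s t ω = c} :=
  hG.measurable_counts s t (MeasurableSet.of_discrete (s := {c}))

/-- The state at time `s` is independent of the event counts after time `s`. -/
lemma setIntegral_comp_state (hG : IsGossipProcess P m lamE lam N K) {φ : State m → ℝ} {C : ℝ}
    (hφ : ∀ x, IsValid x → |φ x| ≤ x.1 + C) {s t : ℝ≥0} (hst : s ≤ t) (c : Event m → ℕ) :
    ∫ ω in {ω | counts N s t ω = c}, φ (state N K s ω) ∂P =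
      P.real {ω | counts N s t ω = c} * ∫ ω, φ (state N K s ω) ∂P := by
  classical
  have := hG.indep.isProbabilityMeasure
  let Z : ℕ → Ω → State m := fun j ω =>
    chain (fun i => counts N (grid s t j i) (grid s t j (i + 1)) ω) (2 ^ j)
  have hZm : ∀ j, Measurable fun ω => φ (Z j ω) := fun j =>
    Measurable.of_discrete.comp (hG.measurable_chain _ _)
  -- The bound does not depend on `j`, because the source coordinate of the chain is the true one.
  have hbound : ∀ j, ∀ᵐ ω ∂P, ‖φ (Z j ω)‖ ≤ N Event.update s ω + C := by
    intro j
    filter_upwards [hG.ae_isRegularPath] with ω hω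
    have h1 := hω.chain_fst (monotone_grid hst j) (grid_zero s t j) (2 ^ j)
    rw [grid_two_pow] at h1
    rw [← h1]
    exact hφ _ (isValid_chain _ _)
  have hlim : ∀ᵐ ω ∂P, Tendsto (fun j => φ (Z j ω)) atTop (𝓝 (φ (state N K s ω))) := by
    filter_upwards [hG.ae_eventually_chain_eq hst] with ω hω
    exact tendsto_const_nhds.congr' (by filter_upwards [hω] with j hj; rw [← hj])
  have hintegrable : Integrable (fun ω => (N Event.update s ω : ℝ) + C) P :=
    (hG.counts_mean s).1.add (integrable_const C)
  have h1 := tendsto_integral_of_dominated_convergence _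
    (fun j => (hZm j).aestronglyMeasurable) hintegrable hbound hlim
  have h2 := tendsto_integral_of_dominated_convergence (μ := P.restrict {ω | counts N s t ω = c}) _
    (fun j => (hZm j).aestronglyMeasurable) hintegrable.integrableOn
    (fun j => ae_restrict_of_ae (hbound j)) (ae_restrict_of_ae hlim)
  -- The factorisation holds exactly for the chain on each grid, whose cell `2 ^ j` is `(s, t]`, and
  -- passes to the limit on both sides.
  refine tendsto_nhds_unique h2 ((h1.const_mul _).congr fun j => ?_)
  have hind := hG.indepFun_chain_counts (monotone_grid hst j) (2 ^ j)
  rw [grid_two_pow, grid_two_pow_add_one] at hind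
  have hmul := (hind.comp (φ := φ) (ψ := fun z => if z = c then (1 : ℝ) else 0)
    Measurable.of_discrete Measurable.of_discrete).integral_fun_mul_eq_mul_integral
      (hZm j).aestronglyMeasurable
      (Measurable.of_discrete.comp (hG.measurable_counts s t)).aestronglyMeasurable
  have hone : ∫ ω, ((fun z => if z = c then (1 : ℝ) else 0) ∘ counts N s t) ω ∂P =
      P.real {ω | counts N s t ω = c} := by
    rw [← integral_indicator_one (hG.measurableSet_counts_eq s t c)]
    congr 1
    funext ω
    simp [Set.indicator_apply]
  rw [hone] at hmul
  rw [mul_comm]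
  refine hmul.symm.trans ?_
  rw [← integral_indicator (hG.measurableSet_counts_eq s t c)]
  congr 1
  funext ω
  simp [Set.indicator_apply, Z]

/-- Decomposition of a mean at time `s + h` according to the events in `(s, s + h]`. -/
lemma integral_comp_state_add (hG : IsGossipProcess P m lamE lam N K) {φ : State m → ℝ} {C : ℝ}
    (hφ : ∀ x, IsValid x → |φ x| ≤ x.1 + C) (s h : ℝ≥0) :
    ∫ ω, φ (state N K (s + h) ω) ∂P = Real.exp (-(totalRate m lamE lam * h)) *
        ∑ o, weight m lamE lam h o * ∫ ω, φ (advance (state N K s ω) o) ∂P +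
      ∫ ω in {ω | ∀ o, counts N s (s + h) ω ≠ smallCount o}, φ (state N K (s + h) ω) ∂P := by
  have hst : s ≤ s + h := by simp
  have hintegrable := hG.integrable_comp_state hφ (s + h)
  have hmeas : ∀ o, MeasurableSet {ω | counts N s (s + h) ω = smallCount o} := fun o =>
    hG.measurableSet_counts_eq _ _ _
  have hc : {ω | ∀ o, counts N s (s + h) ω ≠ smallCount o} =
      (⋃ o, {ω | counts N s (s + h) ω = smallCount o})ᶜ := by
    ext ω
    simp
  rw [hc, ← integral_add_compl (MeasurableSet.iUnion hmeas) hintegrable,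
    integral_iUnion_fintype hmeas _ fun o => hintegrable.integrableOn]
  · congr 1
    rw [Finset.mul_sum]
    refine Finset.sum_congr rfl fun o _ => ?_
    -- The constant is `C + 1` since one event raises the source version by at most `1`.
    rw [← mul_assoc, ← hG.measureReal_counts s h o, ← hG.setIntegral_comp_state
      (φ := fun x => φ (advance x o)) (C := C + 1) _ hst]
    · refine setIntegral_congr_ae (hmeas o) ?_
      filter_upwards [hG.ae_isRegularPath] with ω hω ho
      rw [hω.advance _ _ o hst ho]
    · intro x hx
      refine (hφ _ (hx.advance o)).trans ?_
      have hle : (advance x o).1 ≤ x.1 + 1 := by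
        rcases o with _ | e
        · exact Nat.le_succ _
        · refine Nat.add_le_add_left ?_ _
          rw [smallCount, Pi.single_apply]
          split_ifs <;> simp
      have : ((advance x o).1 : ℝ) ≤ x.1 + 1 := by exact_mod_cast hle
      linarith
  · intro o o' hoo
    rw [Function.onFun, Set.disjoint_left]
    intro ω h1 h2
    exact hoo (smallCount_injective (h1.symm.trans h2))

end IsGossipProcess

end Gossiping

section Limit

variable {Ω : Type*} [MeasurableSpace Ω] {P : Measure Ω} {m : ℕ} {lamE lam : ℝ≥0}
  {N : Event m → ℝ≥0 → Ω → ℕ} {K : ℝ≥0 → Ω → Node m → ℕ}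

/-! ### The differential equation for the mean ages -/

/-- The mean version age of the set `T` at time `t`. -/
noncomputable def setAge (P : Measure Ω) (N : Event m → ℝ≥0 → Ω → ℕ)
    (K : ℝ≥0 → Ω → Node m → ℕ) (T : Finset (Node m)) (t : ℝ≥0) : ℝ :=
  ∫ ω, stateAge T (state N K t ω) ∂P

/-- The mean version age of the set `T` if the event `e` is appended at time `t`. -/
noncomputable def setAgeAfter (P : Measure Ω) (N : Event m → ℝ≥0 → Ω → ℕ)
    (K : ℝ≥0 → Ω → Node m → ℕ) (T : Finset (Node m)) (t : ℝ≥0) (e : Event m) : ℝ :=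
  ∫ ω, stateAge T (advance (state N K t ω) (some e)) ∂P

lemma abs_stateAge_le (T : Finset (Node m)) (x : State m) (hx : IsValid x) :
    |stateAge T x| ≤ x.1 + 0 := by
  rw [abs_of_nonneg (stateAge_nonneg T hx), add_zero]
  exact stateAge_le T x

namespace IsGossipProcess

variable [NeZero m]

lemma integrable_stateAge (hG : IsGossipProcess P m lamE lam N K) (T : Finset (Node m))
    (t : ℝ≥0) : Integrable (fun ω => stateAge T (state N K t ω)) P :=
  hG.integrable_comp_state (abs_stateAge_le T) t

lemma setAge_nonneg (hG : IsGossipProcess P m lamE lam N K) (T : Finset (Node m)) (t : ℝ≥0) :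
    0 ≤ setAge P N K T t :=
  integral_nonneg_of_ae (by
    filter_upwards [hG.ae_isValid t] with ω hω using stateAge_nonneg T hω)

lemma setAge_le (hG : IsGossipProcess P m lamE lam N K) (T : Finset (Node m)) (t : ℝ≥0) :
    setAge P N K T t ≤ lamE * t := by
  rw [← (hG.counts_mean t).2]
  exact integral_mono (hG.integrable_stateAge T t) (hG.counts_mean t).1 fun ω => stateAge_le T _

lemma setAgeAfter_update (hG : IsGossipProcess P m lamE lam N K) (T : Finset (Node m))
    (t : ℝ≥0) : setAgeAfter P N K T t Event.update = setAge P N K T t + 1 := by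
  have := hG.indep.isProbabilityMeasure
  simp_rw [setAgeAfter, stateAge_advance_update]
  rw [integral_add (hG.integrable_stateAge T t) (integrable_const _)]
  simp [setAge]

lemma setAgeAfter_send (hG : IsGossipProcess P m lamE lam N K) (T : Finset (Node m))
    (t : ℝ≥0) (i : Node m) :
    setAgeAfter P N K T t (Event.send i) = if i ∈ T then 0 else setAge P N K T t := by
  have : ∀ᵐ ω ∂P, stateAge T (advance (state N K t ω) (some (Event.send i))) =
      if i ∈ T then 0 else stateAge T (state N K t ω) := by
    filter_upwards [hG.ae_isValid t] with ω hω using stateAge_advance_send T hω i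
  rw [setAgeAfter, integral_congr_ae this]
  split_ifs
  · simp
  · rfl

end IsGossipProcess

lemma setAgeAfter_push (T : Finset (Node m)) (t : ℝ≥0) (i : Node m) (d : Dir) :
    setAgeAfter P N K T t (Event.push i d) =
      if neighbor i d ∈ T then setAge P N K (insert i T) t else setAge P N K T t := by
  simp_rw [setAgeAfter, stateAge_advance_push]
  split_ifs <;> rfl

namespace IsGossipProcess

variable [NeZero m]

lemma setAgeAfter_mem (hG : IsGossipProcess P m lamE lam N K) (T : Finset (Node m))
    (t : ℝ≥0) (e : Event m) :
    0 ≤ setAgeAfter P N K T t e ∧ setAgeAfter P N K T t e ≤ lamE * t + 1 := by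
  have h1 := hG.setAge_nonneg T t
  have h2 := hG.setAge_le T t
  rcases e with _ | i | ⟨i, d⟩
  · rw [hG.setAgeAfter_update]
    constructor <;> linarith
  · rw [hG.setAgeAfter_send]
    split_ifs <;> constructor <;> linarith
  · rw [setAgeAfter_push]
    have h3 := hG.setAge_nonneg (insert i T) t
    have h4 := hG.setAge_le (insert i T) t
    split_ifs <;> constructor <;> linarith

lemma setAge_add (hG : IsGossipProcess P m lamE lam N K) (T : Finset (Node m)) (s h : ℝ≥0) :
    |setAge P N K T (s + h) - Real.exp (-(totalRate m lamE lam * h)) * (setAge P N K T s +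
      h * ∑ e, rate m lamE lam e * setAgeAfter P N K T s e)| ≤
      lamE * s * (totalRate m lamE lam * h) ^ 2 + lamE * h * (totalRate m lamE lam * h) := by
  have := hG.indep.isProbabilityMeasure
  -- The contribution of several events is controlled by the mean of the source version on `B`.
  -- Since its full mean is known, the same decomposition applied to it evaluates this as `lamE (s +
  -- h) - exp (-x) (lamE s (1 + x) + lamE h)`.
  have hN := hG.integral_comp_state_add (φ := fun x => (x.1 : ℝ)) (C := 0)
    (fun x _ => by simp) s h
  have hT := hG.integral_comp_state_add (abs_stateAge_le T) s h
  set B := {ω | ∀ o, counts N s (s + h) ω ≠ smallCount o}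
  set x : ℝ := totalRate m lamE lam * h with hx
  have hx0 : 0 ≤ x := by positivity
  have hN' : ∑ o, weight m lamE lam h o * ∫ ω, ((advance (state N K s ω) o).1 : ℝ) ∂P =
      lamE * s * (1 + x) + lamE * h := by
    have hadv : ∀ o : Option (Event m), ∫ ω, ((advance (state N K s ω) o).1 : ℝ) ∂P =
        lamE * s + smallCount o Event.update := by
      intro o
      have hmean := hG.counts_mean s
      rw [← hmean.2]
      have : ∀ ω, ((advance (state N K s ω) o).1 : ℝ) =
          N Event.update s ω + smallCount o Event.update := by
        intro ω
        rw [← transition_smallCount, transition_fst]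
        push_cast
        rfl
      simp_rw [this]
      rw [integral_add hmean.1 (integrable_const _)]
      simp
    simp_rw [hadv, mul_add, Finset.sum_add_distrib, ← Finset.sum_mul, sum_weight]
    rw [Fintype.sum_option, sum_event]
    simp only [smallCount_send, smallCount_push]
    simp [weight, smallCount, rate, hx]
    ring
  have hT' : ∑ o, weight m lamE lam h o * ∫ ω, stateAge T (advance (state N K s ω) o) ∂P =
      setAge P N K T s + h * ∑ e, rate m lamE lam e * setAgeAfter P N K T s e := by
    rw [Fintype.sum_option, Finset.mul_sum]
    congr 1
    · simp [weight, advance, setAge]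
    · refine Finset.sum_congr rfl fun e _ => ?_
      rw [weight, setAgeAfter]
      ring
  have hNmean : ∫ ω, ((state N K (s + h) ω).1 : ℝ) ∂P = lamE * (s + h) := by
    rw [← NNReal.coe_add]
    exact (hG.counts_mean (s + h)).2
  rw [hN', hNmean] at hN
  rw [hT'] at hT
  have hB0 : 0 ≤ ∫ ω in B, stateAge T (state N K (s + h) ω) ∂P :=
    integral_nonneg_of_ae (ae_restrict_of_ae (by
      filter_upwards [hG.ae_isValid (s + h)] with ω hω using stateAge_nonneg T hω))
  have hB1 : ∫ ω in B, stateAge T (state N K (s + h) ω) ∂P ≤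
      ∫ ω in B, ((state N K (s + h) ω).1 : ℝ) ∂P :=
    integral_mono (hG.integrable_stateAge T _).integrableOn (hG.counts_mean _).1.integrableOn
      fun ω => stateAge_le T _
  rw [setAge, hT, add_sub_cancel_left, abs_of_nonneg hB0]
  refine hB1.trans ?_
  have he := Real.add_one_le_exp (-x)
  have h1 : (lamE : ℝ) * s * ((1 - x) * (1 + x)) ≤ lamE * s * (Real.exp (-x) * (1 + x)) := by
    gcongr
    linarith
  have h2 : (lamE : ℝ) * h * (1 - x) ≤ lamE * h * Real.exp (-x) := by
    gcongr
    linarith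
  linarith

/-- The drift of the mean age of `T`. -/
lemma sum_rate_mul_setAgeAfter (hG : IsGossipProcess P m lamE lam N K) (T : Finset (Node m))
    (t : ℝ≥0) :
    ∑ e, rate m lamE lam e * setAgeAfter P N K T t e - totalRate m lamE lam * setAge P N K T t =
      (lamE + ∑ p ∈ boundary T, lam / 4 * setAge P N K (insert p.1 T) t) -
        lam * (T.card / (m : ℝ) ^ 2 + (boundary T).card / 4) * setAge P N K T t := by
  have h1 : (totalRate m lamE lam : ℝ) = ∑ e : Event m, (rate m lamE lam e : ℝ) := by
    simp [totalRate]
  -- The drift is the sum of rate times change of age, so every event that leaves the age of `T`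
  -- unchanged drops out; this includes pushes inside `T`, where `insert i T = T`.
  rw [h1, Finset.sum_mul, ← Finset.sum_sub_distrib]
  simp_rw [← mul_sub]
  rw [sum_event, hG.setAgeAfter_update]
  simp_rw [hG.setAgeAfter_send, setAgeAfter_push]
  have hs : ∑ i : Node m, (rate m lamE lam (Event.send i) : ℝ) *
      ((if i ∈ T then 0 else setAge P N K T t) - setAge P N K T t) =
      - (lam * (T.card / (m : ℝ) ^ 2) * setAge P N K T t) := by
    have : ∀ i : Node m, (rate m lamE lam (Event.send i) : ℝ) *
        ((if i ∈ T then 0 else setAge P N K T t) - setAge P N K T t) =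
        if i ∈ T then - (lam / (m : ℝ) ^ 2 * setAge P N K T t) else 0 := by
      intro i
      split_ifs <;> simp [rate]
    simp_rw [this]
    rw [Finset.sum_ite_mem, Finset.univ_inter, Finset.sum_const, nsmul_eq_mul]
    ring
  have hp : ∑ p : Node m × Dir, (rate m lamE lam (Event.push p.1 p.2) : ℝ) *
      ((if neighbor p.1 p.2 ∈ T then setAge P N K (insert p.1 T) t else setAge P N K T t) -
        setAge P N K T t) =
      ∑ p ∈ boundary T, lam / 4 * (setAge P N K (insert p.1 T) t - setAge P N K T t) := by
    rw [boundary, Finset.sum_filter]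
    refine Finset.sum_congr rfl fun p _ => ?_
    by_cases h1 : neighbor p.1 p.2 ∈ T <;> by_cases h2 : p.1 ∈ T <;> simp [h1, h2, rate]
  rw [hs, hp]
  simp_rw [mul_sub, Finset.sum_sub_distrib]
  simp [rate]
  ring

lemma continuousOn_and_hasDerivWithinAt_setAge (hG : IsGossipProcess P m lamE lam N K)
    (T : Finset (Node m)) :
    ContinuousOn (fun x : ℝ => setAge P N K T x.toNNReal) (Set.Ici 0) ∧
      ∀ x : ℝ, 0 ≤ x → HasDerivWithinAt (fun x : ℝ => setAge P N K T x.toNNReal)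
        ((lamE + ∑ p ∈ boundary T, lam / 4 * setAge P N K (insert p.1 T) x.toNNReal) -
          lam * (T.card / (m : ℝ) ^ 2 + (boundary T).card / 4) * setAge P N K T x.toNNReal)
        (Set.Ici x) x := by
  simp_rw [← hG.sum_rate_mul_setAgeAfter]
  set R : ℝ := (totalRate m lamE lam : ℝ) with hR
  have hR0 : 0 ≤ R := NNReal.coe_nonneg _
  have hE0 : (0 : ℝ) ≤ lamE := NNReal.coe_nonneg _
  refine continuousOn_and_hasDerivWithinAt_of_step
    (D := fun x : ℝ => ∑ e, rate m lamE lam e * setAgeAfter P N K T x.toNNReal e)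
    -- The three summands serve the bound on the mean age, the bound on `D`, and the quadratic
    -- error, in this order.
    (a := lamE + R * (lamE + 1) + lamE * (R ^ 2 + R)) hR0 ?_ ?_ ?_
  · intro x hx
    have h1 := hG.setAge_le T x.toNNReal
    rw [Real.coe_toNNReal x hx] at h1
    rw [abs_of_nonneg (hG.setAge_nonneg T _)]
    have : 0 ≤ (R * (lamE + 1) + lamE * (R ^ 2 + R)) * (1 + x) := by positivity
    linarith
  · intro x hx
    rw [abs_of_nonneg (Finset.sum_nonneg fun e _ => mul_nonneg (NNReal.coe_nonneg _)
      (hG.setAgeAfter_mem T _ e).1)]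
    calc ∑ e, (rate m lamE lam e : ℝ) * setAgeAfter P N K T x.toNNReal e
        ≤ ∑ e : Event m, (rate m lamE lam e : ℝ) * (lamE * x + 1) := by
          refine Finset.sum_le_sum fun e _ => ?_
          have := (hG.setAgeAfter_mem T x.toNNReal e).2
          rw [Real.coe_toNNReal x hx] at this
          gcongr
      _ = R * (lamE * x + 1) := by
          rw [← Finset.sum_mul, hR, totalRate]
          push_cast
          rfl
      _ ≤ R * (lamE + 1) * (1 + x) := by
          rw [mul_assoc]
          gcongr
          linarith
      _ ≤ _ := by
          have : 0 ≤ (lamE + lamE * (R ^ 2 + R)) * (1 + x) := by positivity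
          linarith
  · intro x h hx hh
    have := hG.setAge_add T x.toNNReal h.toNNReal
    rw [Real.coe_toNNReal x hx, Real.coe_toNNReal h hh, ← Real.toNNReal_add hx hh, ← hR] at this
    refine this.trans ?_
    have h1 : lamE * x * (R * h) ^ 2 + lamE * h * (R * h) =
        (lamE * R ^ 2 * x + lamE * R) * h ^ 2 := by ring
    rw [h1]
    gcongr
    have : 0 ≤ (lamE + R * (lamE + 1)) * (1 + x) := by positivity
    have : 0 ≤ lamE * R ^ 2 := by positivity
    have : 0 ≤ lamE * R * x := by positivity
    linarith

/-- The mean age of every nonempty set of nodes converges. -/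
lemma tendsto_setAge (hG : IsGossipProcess P m lamE lam N K) (hlam : 0 < lam)
    (T : Finset (Node m)) (hT : T.Nonempty) :
    Tendsto (fun x : ℝ => setAge P N K T x.toNNReal) atTop (𝓝 (lamE / lam * meanAge T)) := by
  induction T using boundary_induction with
  | h T ih =>
    obtain ⟨hcont, hderiv⟩ := hG.continuousOn_and_hasDerivWithinAt_setAge T
    have hlam' : (0 : ℝ) < lam := hlam
    have hm : 0 < (m : ℝ) ^ 2 := sq_pos_of_neZero
    have hc : 0 < (T.card : ℝ) := by exact_mod_cast hT.card_pos
    have hq : 0 < (T.card / (m : ℝ) ^ 2 + (boundary T).card / 4) := by positivity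
    have hlim : Tendsto (fun x : ℝ => (lamE : ℝ) + ∑ p ∈ boundary T,
        lam / 4 * setAge P N K (insert p.1 T) x.toNNReal) atTop
        (𝓝 (lamE + ∑ p ∈ boundary T, lam / 4 * (lamE / lam * meanAge (insert p.1 T)))) :=
      (tendsto_finsetSum _ fun p hp => (ih p hp (by simp)).const_mul _).const_add _
    have := tendsto_div_of_deriv_right (mul_pos hlam' hq) hcont hderiv hlim
    convert this using 2
    have hsum : ∑ p ∈ boundary T, (lam : ℝ) / 4 * (lamE / lam * meanAge (insert p.1 T)) =
        lamE * ∑ p ∈ boundary T, meanAge (insert p.1 T) / 4 := by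
      rw [Finset.mul_sum]
      refine Finset.sum_congr rfl fun p _ => ?_
      field_simp
    rw [hsum, meanAge_eq, div_mul_div_comm]
    ring

lemma integrable_versionAge_and_tendsto (hG : IsGossipProcess P m lamE lam N K) (hlam : 0 < lam)
    (i : Node m) :
    (∀ t, Integrable (versionAge N K i t) P) ∧
      Tendsto (fun t => ∫ ω, versionAge N K i t ω ∂P) atTop
        (𝓝 (lamE / lam * meanAge {(0 : Node m)})) := by
  have h : ∀ t, versionAge N K i t = fun ω => stateAge {i} (state N K t ω) := by
    intro t
    funext ω
    simp [versionAge, stateAge, state]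
  simp_rw [h]
  refine ⟨hG.integrable_stateAge {i}, ?_⟩
  have := (hG.tendsto_setAge hlam {i} (by simp)).comp
    (NNReal.tendsto_coe_atTop.2 tendsto_id)
  rw [meanAge_singleton] at this
  simpa [Function.comp_def, setAge] using this

end IsGossipProcess

end Limit

/-! ### Bounds on the limiting age of a single node -/

lemma meanAge_nonneg {m : ℕ} [NeZero m] (T : Finset (Node m)) : 0 ≤ meanAge T := by
  induction T using boundary_induction with
  | h T ih =>
    rw [meanAge_eq]
    have := Finset.sum_nonneg fun p hp => div_nonneg (ih p hp) (by norm_num : (0 : ℝ) ≤ 4)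
    positivity

/-- The limiting mean version age of a node of the `m × m` grid, for `lamE = lam`. -/
noncomputable def limitAge : ℕ → ℝ
  | 0 => 0
  | m + 1 => meanAge {(0 : Node (m + 1))}

lemma limitAge_eq (m : ℕ) [NeZero m] : limitAge m = meanAge {(0 : Node m)} := by
  obtain ⟨k, rfl⟩ := Nat.exists_eq_succ_of_ne_zero (NeZero.ne m)
  rfl

lemma limitAge_le {m : ℕ} (hm : 1 ≤ m) :
    limitAge m ≤ 3 * ((m : ℝ) ^ 2) ^ (1 / 3 : ℝ) + 729 * Real.log ((m : ℝ) ^ 2) + 1 := by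
  have : NeZero m := ⟨by omega⟩
  have hm' : (1 : ℝ) ≤ m := by exact_mod_cast hm
  have hlog : 0 ≤ Real.log ((m : ℝ) ^ 2) := Real.log_nonneg (one_le_pow₀ hm')
  have hc : 0 ≤ ((m : ℝ) ^ 2) ^ (1 / 3 : ℝ) := by positivity
  rw [limitAge_eq]
  -- For `2 ≤ m < 27` the age is at most `m^2 ≤ 27^2 = 729` and `log (m^2) ≥ 1`; for `m = 1` the
  -- logarithm vanishes and the summand `1` suffices.
  rcases lt_or_ge m 27 with h | h
  · have hn := meanAge_le_div_card {(0 : Node m)} (by simp)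
    rw [Finset.card_singleton, Nat.cast_one, div_one] at hn
    rcases hm.eq_or_lt with h1 | h1
    · subst h1
      norm_num at hn ⊢
      linarith
    · have h2 : (2 : ℝ) ≤ m := by exact_mod_cast h1
      have h27 : (m : ℝ) ≤ 27 := by exact_mod_cast h.le
      have hlog1 : 1 ≤ Real.log ((m : ℝ) ^ 2) := by
        have h3 : Real.log 2 ≤ Real.log m := Real.log_le_log (by norm_num) h2
        have := Real.log_two_gt_d9
        rw [Real.log_pow]
        push_cast
        linarith
      nlinarith
  · linarith [meanAge_singleton_le h (0 : Node m)]

lemma limitAge_isBigO : limitAge =O[atTop] fun m : ℕ => ((m : ℝ) ^ 2) ^ (1 / 3 : ℝ) := by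
  refine IsBigO.of_bound 3 ?_
  filter_upwards [eventually_ge_atTop 27] with m hm
  have : NeZero m := ⟨by omega⟩
  rw [limitAge_eq, Real.norm_of_nonneg (meanAge_nonneg _), Real.norm_of_nonneg (by positivity)]
  exact meanAge_singleton_le hm _

end Gossip

theorem theorem1 :
    ∃ ν : ℝ, ∀ lamE lam : ℝ≥0, 0 < lamE → 0 < lam →
      ∃ v : ℕ → ℝ,
        (∀ m : ℕ, 1 ≤ m →
          ∀ {Ω : Type*} [MeasurableSpace Ω] (P : Measure Ω) [IsProbabilityMeasure P]
            (N : Gossip.Event m → ℝ≥0 → Ω → ℕ) (K : ℝ≥0 → Ω → Gossip.Node m → ℕ),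
            Gossip.IsGossipProcess P m lamE lam N K →
            ∀ i : Gossip.Node m,
              (∀ t, Integrable (Gossip.versionAge N K i t) P) ∧
              Tendsto (fun t => ∫ ω, Gossip.versionAge N K i t ω ∂P) atTop (𝓝 (v m))) ∧
        (∀ m : ℕ, 1 ≤ m →
          v m ≤ 2 * lamE / lam * (1 + Gossip.betaPrime * ((m : ℝ) ^ 2) ^ (1 / 3 : ℝ))
            + lamE / lam * (2 + ν * Real.log ((m : ℝ) ^ 2))) ∧
        v =O[atTop] (fun m : ℕ => ((m : ℝ) ^ 2) ^ (1 / 3 : ℝ)) := by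
  -- The constant `729 = 27^2` comes from the small grids in `limitAge_le`.
  refine ⟨729, fun lamE lam _ hlam => ⟨fun m => lamE / lam * Gossip.limitAge m, ?_, ?_, ?_⟩⟩
  · intro m hm Ω _ P _ N K hG i
    have : NeZero m := ⟨by omega⟩
    beta_reduce
    rw [Gossip.limitAge_eq]
    exact hG.integrable_versionAge_and_tendsto hlam i
  · intro m hm
    have hc : 0 ≤ ((m : ℝ) ^ 2) ^ (1 / 3 : ℝ) := by positivity
    have h1 := mul_le_mul_of_nonneg_right Gossip.three_halves_le_betaPrime hc
    have h2 := Gossip.limitAge_le hm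
    have h3 : (lamE / lam * Gossip.limitAge m : ℝ) ≤ lamE / lam *
        (2 * (1 + Gossip.betaPrime * ((m : ℝ) ^ 2) ^ (1 / 3 : ℝ)) +
          (2 + 729 * Real.log ((m : ℝ) ^ 2))) := by
      gcongr
      linarith
    refine h3.trans (le_of_eq ?_)
    ring
  · exact Gossip.limitAge_isBigO.const_mul_left _
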